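/- Let $K$ be a field of characteristic $0$ and $n \ge 1$ an integer. Let $K(\mathbf q)$ be the field of rational functions over $K$ in variables $q_1,\dots,q_n$ subject to the single relation $q_1q_2\cdots q_n=1$, that is, the field of fractions of the integral domain $K[q_1,\dots,q_n]/(q_1q_2\cdots q_n-1)$. For $\sigma$ in the symmetric group $S_n$ let $D(\sigma)=\{\,j : 1\le j\le n-1,\ \sigma(j)>\sigma(j+1)\,\}$ be its descent set, and define its $\mathbf q$-major index by $$\mathrm{maj}_{\mathbf q}(\sigma)=\frac{\prod_{j\in D(\sigma)} q_{\sigma(1)}q_{\sigma(2)}\cdots q_{\sigma(j)}}{\prod_{i=1}^{n-1}\bigl(1-q_{\sigma(1)}q_{\sigma(2)}\cdots q_{\sigma(i)}\bigr)}\in K(\mathbf q).$$ Let $K(\mathbf q)S_n$ be the $K(\mathbf q)$-vector space with basis $S_n$, regarded as a subspace of the free associative algebra $K(\mathbf q)\langle 1,\dots,n\rangle$ by identifying $\sigma$ with the word $\sigma(1)\sigma(2)\cdots\sigma(n)$. Let $\mathcal L_{K(\mathbf q)}(\{1,\dots,n\})$ be the smallest $K(\mathbf q)$-subspace of $K(\mathbf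 q)\langle 1,\dots,n\rangle$ that contains the letters $1,\dots,n$ and is closed under the bracket $[a,b]=ab-ba$. Then the element $$e_n(\mathbf q)=\sum_{\sigma\in S_n}\mathrm{maj}_{\mathbf q}(\sigma)\,\sigma$$ is a Lie element, that is, $$e_n(\mathbf q)\in K(\mathbf q)S_n\cap\mathcal L_{K(\mathbf q)}(\{1,\dots,n\}).$$ -/

import Mathlib

noncomputable section

namespace QKlyachko

-- Associative algebras carry the commutator bracket `a * b - b * a`.
attribute [local instance] LieRing.ofAssociativeRing

/-- The ideal of `K[q_1, …, q_n]` generated by `q_1 q_2 ⋯ q_n - 1`. -/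
def relIdeal (K : Type*) [Field K] (n : ℕ) : Ideal (MvPolynomial (Fin n) K) :=
  Ideal.span {(∏ i : Fin n, MvPolynomial.X i) - 1}

/-- The coordinate ring `K[q_1, …, q_n] / (q_1 q_2 ⋯ q_n - 1)`. -/
abbrev ParamRing (K : Type*) [Field K] (n : ℕ) : Type _ :=
  MvPolynomial (Fin n) K ⧸ relIdeal K n

/-- The ideal `(q_1 ⋯ q_n - 1)` is prime, so that its quotient has a field of fractions. -/
instance relIdeal_isPrime (K : Type*) [Field K] (n : ℕ) : (relIdeal K n).IsPrime := by
  cases n with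
  | zero =>
    have : relIdeal K 0 = ⊥ := by simp [relIdeal]
    rw [this]
    exact Ideal.isPrime_bot
  | succ m =>
    have hne : (∏ i : Fin m, (MvPolynomial.X i : MvPolynomial (Fin m) K)) ≠ 0 :=
      Finset.prod_ne_zero_iff.2 fun i _ => MvPolynomial.X_ne_zero i
    have hirr : Irreducible (Polynomial.C (∏ i : Fin m, (MvPolynomial.X i : MvPolynomial (Fin m) K))
        * Polynomial.X + Polynomial.C (-1)) := by
      refine Polynomial.irreducible_C_mul_X_add_C hne ?_
      exact (isUnit_one.neg).isRelPrime_right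
    have hmap : MvPolynomial.finSuccEquiv K m
        ((∏ i : Fin (m + 1), MvPolynomial.X i) - 1) =
        Polynomial.C (∏ i : Fin m, (MvPolynomial.X i : MvPolynomial (Fin m) K))
          * Polynomial.X + Polynomial.C (-1) := by
      rw [map_sub, map_prod, Fin.prod_univ_succ]
      simp only [MvPolynomial.finSuccEquiv_X_zero, MvPolynomial.finSuccEquiv_X_succ, map_one,
        map_neg, map_prod]
      ring
    have h2 : Irreducible ((∏ i : Fin (m + 1), (MvPolynomial.X i : MvPolynomial (Fin (m + 1)) K))
        - 1) := by
      rw [← MulEquiv.irreducible_iff (MvPolynomial.finSuccEquiv K m), hmap]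
      exact hirr
    exact (Ideal.span_singleton_prime h2.ne_zero).2 h2.prime

/-- The field `K(q)` of rational functions in variables `q_1, …, q_n` subject to the single
relation `q_1 q_2 ⋯ q_n = 1`. -/
def ParamField (K : Type*) [Field K] (n : ℕ) : Type _ :=
  FractionRing (ParamRing K n)

instance (K : Type*) [Field K] (n : ℕ) : Field (ParamField K n) :=
  inferInstanceAs (Field (FractionRing (ParamRing K n)))

instance (K : Type*) [Field K] (n : ℕ) : Algebra (ParamRing K n) (ParamField K n) :=
  inferInstanceAs (Algebra (ParamRing K n) (FractionRing (ParamRing K n)))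

instance (K : Type*) [Field K] (n : ℕ) : IsFractionRing (ParamRing K n) (ParamField K n) :=
  inferInstanceAs (IsFractionRing (ParamRing K n) (FractionRing (ParamRing K n)))

/-- The variable `q_i`, as an element of `K(q)`. -/
def q (K : Type*) [Field K] {n : ℕ} (i : Fin n) : ParamField K n :=
  algebraMap (ParamRing K n) (ParamField K n) (Ideal.Quotient.mk (relIdeal K n) (MvPolynomial.X i))

/-- The product `q_{σ(1)} q_{σ(2)} ⋯ q_{σ(j)}` over the first `j` positions of `σ`. -/
def prefixProd (K : Type*) [Field K] {n : ℕ} (σ : Equiv.Perm (Fin n)) (j : ℕ) : ParamField K n :=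
  ∏ i ∈ Finset.univ.filter (fun i : Fin n => (i : ℕ) < j), q K (σ i)

/-- The descent set `{j | 1 ≤ j ≤ n - 1, σ(j) > σ(j+1)}`. Positions are counted from `1`, so
the `j`-th letter of `σ` is the value of `σ` at the element `j - 1` of `Fin n`. -/
def descentSet {n : ℕ} (σ : Equiv.Perm (Fin n)) : Finset ℕ :=
  {j ∈ Finset.Ico 1 n | ∃ a b : Fin n, (a : ℕ) + 1 = j ∧ (b : ℕ) = j ∧ σ b < σ a}

/-- The `q`-major index of `σ`. -/
def qMaj (K : Type*) [Field K] {n : ℕ} (σ : Equiv.Perm (Fin n)) : ParamField K n :=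
  (∏ j ∈ descentSet σ, prefixProd K σ j) / ∏ i ∈ Finset.Ico 1 n, (1 - prefixProd K σ i)

/-- The space `K(q) S_n` of formal linear combinations of permutations with coefficients
in `K(q)`. -/
abbrev SymSpace (K : Type*) [Field K] (n : ℕ) : Type _ :=
  Equiv.Perm (Fin n) →₀ ParamField K n

/-- The element `e_n(q) = ∑_σ maj_q(σ) σ` of `K(q) S_n`. -/
def klyachko (K : Type*) [Field K] (n : ℕ) : SymSpace K n :=
  ∑ σ : Equiv.Perm (Fin n), Finsupp.single σ (qMaj K σ)

/-- The free associative algebra `K(q)⟨1, …, n⟩`. -/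
abbrev WordAlgebra (K : Type*) [Field K] (n : ℕ) : Type _ :=
  FreeAlgebra (ParamField K n) (Fin n)

/-- The permutation `σ` read as the word `σ(1) σ(2) ⋯ σ(n)`. -/
def permWord (K : Type*) [Field K] {n : ℕ} (σ : Equiv.Perm (Fin n)) : WordAlgebra K n :=
  (List.ofFn fun i => FreeAlgebra.ι (ParamField K n) (σ i)).prod

/-- The linear embedding of `K(q) S_n` in `K(q)⟨1, …, n⟩` sending each permutation to its word. -/
def toWords (K : Type*) [Field K] (n : ℕ) : SymSpace K n →ₗ[ParamField K n] WordAlgebra K n :=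
  Finsupp.linearCombination (ParamField K n) (permWord K)

/-- The smallest subspace of `K(q)⟨1, …, n⟩` that contains the letters and is closed under the
bracket `[a, b] = a b - b a`. -/
def freeLie (K : Type*) [Field K] (n : ℕ) : LieSubalgebra (ParamField K n) (WordAlgebra K n) :=
  LieSubalgebra.lieSpan (ParamField K n) (WordAlgebra K n)
    (Set.range (FreeAlgebra.ι (ParamField K n)))

/-- The space of Lie elements: the intersection of `K(q) S_n` with the Lie subalgebra generated
by the letters. -/
def lieElements (K : Type*) [Field K] (n : ℕ) :
    Submodule (ParamField K n) (WordAlgebra K n) :=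
  LinearMap.range (toWords K n) ⊓ (freeLie K n).toSubmodule

end QKlyachko

end

/-! Fix one letter `0`. The iterated brackets `[w_m, [..., [w_1, 0]]]` are Lie elements, and
expanding one gives the signed sum of words `a.reverse ++ 0 :: b` over all splittings of `w` into a
subsequence `a` and its complement `b`, with sign `(-1) ^ b.length`. So it suffices that the
coefficient of `a.reverse ++ 0 :: b` in the Klyachko element is `(-1) ^ b.length` times the sum,
over shuffles `w` of `a` and `b`, of the coefficient of `w.reverse ++ [0]`.

Two identities give this. Since all the variables multiply to `1`, the factors belonging to the
letters after `0` can be turned around one at a time, each at the cost of a sign, which leaves a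
product of two chain generating functions (`majGF_reverse_append`). By P-partition theory such a
product is the sum over all shuffles of the two chains (`sum_shuffle_chainGF`). Words are stored
reversed, so that a prefix product becomes the product over a tail of the list. -/

namespace QKlyachko

/-! ### Shuffles and splittings as adjoint operations. -/

section Shuffle

variable {α : Type*}

/-- All shuffles of two lists, with multiplicity. -/
def shuffle : List α → List α → List (List α)
  | [], v => [v]
  | u, [] => [u]
  | c :: u, d :: v =>
    (shuffle u (d :: v)).map (List.cons c) ++ (shuffle (c :: u) v).map (List.cons d)
termination_by u v => u.length + v.length

/-- All ways of splitting a list into a subsequence and its complement, with multiplicity. -/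
def splits : List α → List (List α × List α)
  | [] => [([], [])]
  | c :: w => (splits w).map (fun p => (c :: p.1, p.2)) ++ (splits w).map (fun p => (p.1, c :: p.2))

@[simp] theorem shuffle_nil_left (v : List α) : shuffle [] v = [v] := by simp [shuffle]

@[simp] theorem shuffle_nil_right (u : List α) : shuffle u [] = [u] := by
  cases u <;> simp [shuffle]

theorem shuffle_cons_cons (c d : α) (u v : List α) :
    shuffle (c :: u) (d :: v) =
      (shuffle u (d :: v)).map (List.cons c) ++ (shuffle (c :: u) v).map (List.cons d) := by
  rw [shuffle]

theorem perm_of_mem_shuffle (u v : List α) : ∀ w ∈ shuffle u v, w.Perm (u ++ v) := by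
  induction u generalizing v with
  | nil => simp
  | cons c u ihu =>
    induction v with
    | nil => simp
    | cons d v ihv =>
      intro w hw
      rw [shuffle_cons_cons, List.mem_append, List.mem_map, List.mem_map] at hw
      rcases hw with ⟨w, hw, rfl⟩ | ⟨w, hw, rfl⟩
      · exact (ihu _ w hw).cons c
      · exact ((ihv w hw).cons d).trans List.perm_middle.symm

theorem perm_of_mem_splits (w : List α) : ∀ p ∈ splits w, w.Perm (p.1 ++ p.2) := by
  induction w with
  | nil => simp [splits]
  | cons c w ih =>
    intro p hp
    rw [splits, List.mem_append, List.mem_map, List.mem_map] at hp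
    rcases hp with ⟨p, hp, rfl⟩ | ⟨p, hp, rfl⟩
    · exact (ih p hp).cons c
    · exact ((ih p hp).cons c).trans List.perm_middle.symm

theorem count_map_cons [DecidableEq α] (c d : α) (w : List α) (l : List (List α)) :
    (l.map (List.cons c)).count (d :: w) = if c = d then l.count w else 0 := by
  induction l with
  | nil => simp
  | cons x l ih =>
    simp only [List.map_cons, List.count_cons, ih]
    by_cases h : c = d <;> simp [h]

/-- Both multiplicities count the ways to colour the letters of `w` so that the two colour classes
spell `u` and `v`; both satisfy the same recursion on the first letter of `w`. -/
theorem count_splits [DecidableEq α] (w u v : List α) :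
    (splits w).count (u, v) = (shuffle u v).count w := by
  have key : ∀ (c : α) (l : List (List α × List α)) (u v : List α),
      (l.map (fun p => (c :: p.1, p.2))).count (u, v) =
        match u with
        | [] => 0
        | d :: u => if c = d then l.count (u, v) else 0 := by
    intro c l u v
    induction l with
    | nil => cases u <;> simp
    | cons x l ih =>
      cases u with
      | nil => simp_all
      | cons d u =>
        simp only [List.map_cons, List.count_cons] at ih ⊢
        rw [ih]
        by_cases h : c = d <;> simp [h, Prod.ext_iff]
  have key' : ∀ (c : α) (l : List (List α × List α)) (u v : List α),
      (l.map (fun p => (p.1, c :: p.2))).count (u, v) =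
        match v with
        | [] => 0
        | d :: v => if c = d then l.count (u, v) else 0 := by
    intro c l u v
    induction l with
    | nil => cases v <;> simp
    | cons x l ih =>
      cases v with
      | nil => simp_all
      | cons d v =>
        simp only [List.map_cons, List.count_cons] at ih ⊢
        rw [ih]
        by_cases h : c = d <;> simp [h, Prod.ext_iff]
  induction w generalizing u v with
  | nil =>
    cases u with
    | nil => cases v <;> simp [splits]
    | cons c u =>
      cases v with
      | nil => simp [splits]
      | cons d v =>
        rw [shuffle_cons_cons, List.count_append,
          List.count_eq_zero_of_not_mem (l := List.map _ _) (by simp),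
          List.count_eq_zero_of_not_mem (l := List.map _ _) (by simp)]
        simp [splits]
  | cons c w ih =>
    rw [splits, List.count_append, key, key']
    cases u with
    | nil =>
      cases v with
      | nil => simp
      | cons d v =>
        rcases eq_or_ne c d with rfl | h
        · simp [ih, List.count_singleton]
        · simp [h, h.symm]
    | cons e u =>
      cases v with
      | nil =>
        rcases eq_or_ne c e with rfl | h
        · simp [ih, List.count_singleton]
        · simp [h, h.symm]
      | cons d v =>
        simp only [shuffle_cons_cons, List.count_append, count_map_cons, ih, eq_comm]

theorem sum_map_eq_sum_count {β M : Type*} [BEq β] [LawfulBEq β] [AddCommMonoid M]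
    (Q : Finset β) (l : List β) (h : ∀ p ∈ l, p ∈ Q) (f : β → M) :
    (l.map f).sum = ∑ p ∈ Q, l.count p • f p := by
  classical
  induction l with
  | nil => simp
  | cons a l ih =>
    have ha := h a List.mem_cons_self
    simp [List.count_cons, add_smul, Finset.sum_add_distrib, ite_smul, ha, add_comm,
      ih fun p hp => h p (List.mem_cons_of_mem _ hp)]

/-- Interchange of summation between splittings of permutations of a list and shuffles. -/
theorem sum_splits_eq_sum_shuffle [DecidableEq α] {M : Type*} [AddCommMonoid M]
    (P : Finset (List α)) (Q : Finset (List α × List α))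
    (hPQ : ∀ w ∈ P, ∀ p ∈ splits w, p ∈ Q) (hQP : ∀ p ∈ Q, ∀ w ∈ shuffle p.1 p.2, w ∈ P)
    (f : List α → List α × List α → M) :
    ∑ w ∈ P, ((splits w).map (f w)).sum =
      ∑ p ∈ Q, ((shuffle p.1 p.2).map fun w => f w p).sum := by
  have h1 : ∀ w ∈ P, ((splits w).map (f w)).sum =
      ∑ p ∈ Q, (shuffle p.1 p.2).count w • f w p := by
    intro w hw
    rw [sum_map_eq_sum_count Q _ (hPQ w hw)]
    exact Finset.sum_congr rfl fun p _ => by rw [← count_splits]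
  have h2 : ∀ p ∈ Q, ((shuffle p.1 p.2).map fun w => f w p).sum =
      ∑ w ∈ P, (shuffle p.1 p.2).count w • f w p :=
    fun p hp => sum_map_eq_sum_count P _ (hQP p hp) _
  rw [Finset.sum_congr rfl h1, Finset.sum_congr rfl h2, Finset.sum_comm]

end Shuffle

/-! ### Two identities for chain generating functions. -/

section GeneratingFunction

variable {α L : Type*} [LinearOrder α] [Field L] (t : α → L)

/-- The factor contributed by a possible descent when the letter `c` is appended to the word
whose reversal is the given list. -/
def gate (c : α) : List α → L
  | [] => 1
  | d :: u => if c < d then ((d :: u).map t).prod else 1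

/-- The `P`-partition generating function of the chain given by a reversed word. -/
def chainGF : List α → L
  | [] => 1
  | c :: u => gate t c u * chainGF u / (1 - ((c :: u).map t).prod)

/-- Linear extensions of a disjoint union of two chains are the shuffles, while its generating
function is the product. The letter `a`, to be appended next, has to be carried along because the
induction removes the last letter of the word, which then plays the role of `a`. -/
theorem sum_shuffle_chainGF (u v : List α) (hnd : (u ++ v).Nodup)
    (ht : ∀ w : List α, w ≠ [] → w.Subperm (u ++ v) → (w.map t).prod ≠ 1) (a : α) :
    ((shuffle u v).map fun w => gate t a w * chainGF t w).sum =
      gate t a u * chainGF t u * (gate t a v * chainGF t v) := by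
  induction u generalizing v a with
  | nil => simp [gate, chainGF]
  | cons c u ihu =>
    induction v generalizing a with
    | nil => simp [gate, chainGF]
    | cons d v ihv =>
      set qu := ((c :: u).map t).prod with hqu
      set qv := ((d :: v).map t).prod with hqv
      have hcd : c ≠ d := by
        rintro rfl
        simp at hnd
      have hu1 : 1 - qu ≠ 0 := sub_ne_zero.2
        (ht _ (by simp) (List.sublist_append_left _ _).subperm).symm
      have hv1 : 1 - qv ≠ 0 := sub_ne_zero.2
        (ht _ (by simp) (List.sublist_append_right _ _).subperm).symm
      have huv1 : 1 - qu * qv ≠ 0 := by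
        have := ht ((c :: u) ++ (d :: v)) (by simp) (List.Subperm.refl _)
        rw [List.map_append, List.prod_append] at this
        exact sub_ne_zero.2 this.symm
      have e1 := ihu (d :: v) (List.nodup_cons.1 hnd).2
        (fun w hw hs => ht w hw (hs.trans (List.sublist_cons_self _ _).subperm)) c
      have hsub : ((c :: u) ++ v).Sublist ((c :: u) ++ (d :: v)) :=
        (List.sublist_cons_self d v).append_left _
      have e2 := ihv (hnd.sublist hsub) (fun w hw hs => ht w hw (hs.trans hsub.subperm)) d
      have s1 : (((shuffle u (d :: v)).map (List.cons c)).map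
          fun w => gate t a w * chainGF t w).sum =
          (if a < c then qu * qv else 1) / (1 - qu * qv) *
            ((shuffle u (d :: v)).map fun w => gate t c w * chainGF t w).sum := by
        rw [List.map_map, ← List.sum_map_mul_left]
        refine congrArg List.sum (List.map_congr_left fun w hw => ?_)
        have hp : ((c :: w).map t).prod = qu * qv := by
          rw [(((perm_of_mem_shuffle _ _ w hw).cons c).map t).prod_eq, ← List.cons_append,
            List.map_append, List.prod_append]
        simp only [Function.comp, gate, chainGF, hp]
        ring
      have s2 : (((shuffle (c :: u) v).map (List.cons d)).map
          fun w => gate t a w * chainGF t w).sum =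
          (if a < d then qu * qv else 1) / (1 - qu * qv) *
            ((shuffle (c :: u) v).map fun w => gate t d w * chainGF t w).sum := by
        rw [List.map_map, ← List.sum_map_mul_left]
        refine congrArg List.sum (List.map_congr_left fun w hw => ?_)
        have hp : ((d :: w).map t).prod = qu * qv := by
          rw [((((perm_of_mem_shuffle _ _ w hw).cons d).trans
            List.perm_middle.symm).map t).prod_eq, List.map_append, List.prod_append]
        simp only [Function.comp, gate, chainGF, hp]
        ring
      rw [shuffle_cons_cons, List.map_append, List.sum_append, s1, s2, e1, e2]
      simp only [gate, chainGF, ← hqu, ← hqv]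
      generalize gate t c u * chainGF t u = x
      generalize gate t d v * chainGF t v = y
      -- Only the relative order of `a`, `c`, `d` matters now; each case is a rational identity in
      -- `qu` and `qv`, in which a factor `1 - qu * qv` cancels.
      rcases lt_or_gt_of_ne hcd with h | h
      · by_cases h1 : a < c
        · simp only [h, h.not_gt, h1, h1.trans h, if_true, if_false]
          field_simp
          ring
        · by_cases h2 : a < d
          · simp only [h, h.not_gt, h1, h2, if_true, if_false]
            field_simp
            ring
          · simp only [h, h.not_gt, h1, h2, if_true, if_false]
            field_simp
            ring
      · by_cases h1 : a < d
        · simp only [h, h.not_gt, h1, h1.trans h, if_true, if_false]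
          field_simp
          ring
        · by_cases h2 : a < c
          · simp only [h, h.not_gt, h1, h2, if_true, if_false]
            field_simp
            ring
          · simp only [h, h.not_gt, h1, h2, if_true, if_false]
            field_simp
            ring

/-- The `q`-major index of a nonempty reversed word. -/
def majGF : List α → L
  | [] => 1
  | c :: u => gate t c u * chainGF t u

/-- Each induction step moves the distinguished letter by one place, trading the factor at a prefix
for the factor at the complementary suffix. -/
theorem majGF_reverse_append (b : List α) (x : α) (a : List α) (hnd : (b ++ x :: a).Nodup)
    (h1 : ((b ++ x :: a).map t).prod = 1)
    (ht : ∀ w : List α, w ≠ [] → w.Subperm b → (w.map t).prod ≠ 1) :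
    majGF t (b.reverse ++ x :: a) =
      (-1) ^ b.length * (gate t x a * chainGF t a * (gate t x b * chainGF t b)) := by
  induction b generalizing x a with
  | nil => simp [majGF, gate, chainGF]
  | cons y b ih =>
    have hperm : ((y :: b) ++ x :: a).Perm (b ++ y :: x :: a) := List.perm_middle.symm
    have hxy : x ≠ y := by
      rintro rfl
      simp at hnd
    have e := ih y (x :: a) (hperm.nodup_iff.1 hnd) (by rw [← (hperm.map t).prod_eq, h1])
      (fun w hw hs => ht w hw (hs.trans (List.sublist_cons_self _ _).subperm))
    rw [List.reverse_cons, List.append_assoc, List.singleton_append, e]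
    rw [List.map_append, List.prod_append] at h1
    have hb := ht (y :: b) (by simp) (List.Subperm.refl _)
    have hx : ((x :: a).map t).prod ≠ 1 := by
      intro h
      rw [h, mul_one] at h1
      exact hb h1
    set B := ((y :: b).map t).prod with hB
    set X := ((x :: a).map t).prod with hX
    have hB1 : 1 - B ≠ 0 := sub_ne_zero.2 hb.symm
    have hX1 : 1 - X ≠ 0 := sub_ne_zero.2 hx.symm
    -- From `B * X = 1` one gets `X / (1 - X) = -1 / (1 - B)` and `1 / (1 - X) = -B / (1 - B)`; as
    -- `x ≠ y`, a descent read one way is an ascent read the other way.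
    have key : (if y < x then X else 1) / (1 - X) = -((if x < y then B else 1) / (1 - B)) := by
      rw [← neg_div, div_eq_div_iff hX1 hB1]
      rcases lt_or_gt_of_ne hxy with h | h
      · simp only [h, h.not_gt, if_true, if_false]
        linear_combination -h1
      · simp only [h, h.not_gt, if_true, if_false]
        linear_combination -h1
    rw [List.length_cons, pow_succ, chainGF, chainGF, gate.eq_2 t y, gate.eq_2 t x, ← hB, ← hX]
    linear_combination (-1) ^ b.length * (gate t x a * chainGF t a) *
      (gate t y b * chainGF t b) * key

end GeneratingFunction

/-! ### Expansion of iterated brackets. -/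

section Bracket

variable {α R : Type*} [CommRing R]

/-- The product of the letters of a list in the free algebra. -/
def listWord (R : Type*) [CommRing R] (l : List α) : FreeAlgebra R α :=
  (l.map (FreeAlgebra.ι R)).prod

/-- Each bracket puts its letter either on the left, outside the earlier ones (hence the reversal),
or on the right with a minus sign. -/
theorem foldl_bracket (r : List α) (y : FreeAlgebra R α) :
    r.foldl (fun z c => FreeAlgebra.ι R c * z - z * FreeAlgebra.ι R c) y =
      ((splits r).map fun p => (-1 : R) ^ p.2.length •
        (listWord R p.1.reverse * y * listWord R p.2)).sum := by
  induction r generalizing y with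
  | nil => simp [splits, listWord]
  | cons c r ih =>
    rw [List.foldl_cons, ih, splits, List.map_append, List.sum_append, List.map_map, List.map_map,
      ← List.sum_map_add]
    refine congrArg List.sum (List.map_congr_left fun p _ => ?_)
    simp only [Function.comp, listWord, List.reverse_cons, List.map_append, List.prod_append,
      List.map_cons, List.prod_cons, List.map_nil, List.prod_nil, List.length_cons, pow_succ,
      mul_neg, mul_one, neg_smul, ← sub_eq_add_neg, ← smul_sub]
    congr 1
    noncomm_ring

attribute [local instance] LieRing.ofAssociativeRing in
theorem foldl_bracket_mem (H : LieSubalgebra R (FreeAlgebra R α))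
    (hH : ∀ c, FreeAlgebra.ι R c ∈ H) (r : List α) (y : FreeAlgebra R α) (hy : y ∈ H) :
    r.foldl (fun z c => FreeAlgebra.ι R c * z - z * FreeAlgebra.ι R c) y ∈ H := by
  induction r generalizing y with
  | nil => exact hy
  | cons c r ih => exact ih _ (H.lie_mem (hH c) hy)

end Bracket


/-! ### Products of the variables, and the `q`-major index in terms of reversed prefixes. -/

section Field

variable (K : Type*) [Field K]

theorem prod_q_univ (n : ℕ) : ∏ i : Fin n, q K i = 1 := by
  have h : Ideal.Quotient.mk (relIdeal K n) ((∏ i : Fin n, MvPolynomial.X i) - 1) = 0 :=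
    Ideal.Quotient.eq_zero_iff_mem.2 (Ideal.subset_span rfl)
  rw [map_sub, map_one, sub_eq_zero, map_prod] at h
  simp only [q]
  rw [← map_prod, h, map_one]

/-- The only relation among the variables is that the product of all of them is `1`. -/
theorem prod_q_ne_one [CharZero K] {n : ℕ} (s : Finset (Fin n)) {i j : Fin n} (hi : i ∈ s)
    (hj : j ∉ s) : ∏ k ∈ s, q K k ≠ 1 := by
  intro h
  have hij : j ≠ i := fun e => hj (e ▸ hi)
  simp only [q] at h
  rw [← map_prod, ← map_prod, ← map_one (algebraMap (ParamRing K n) (ParamField K n))] at h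
  have h' := IsFractionRing.injective (ParamRing K n) (ParamField K n) h
  rw [← map_one (Ideal.Quotient.mk (relIdeal K n)), Ideal.Quotient.eq, relIdeal,
    Ideal.mem_span_singleton] at h'
  obtain ⟨r, hr⟩ := h'
  -- A point of the hypersurface where all coordinates multiply to `1`, at which the product over
  -- `s` is `2`; characteristic zero makes `2` invertible.
  let y : Fin n → K := fun k => if k = i then 2 else if k = j then 2⁻¹ else 1
  have hr' := congrArg (MvPolynomial.eval y) hr
  have hy1 : ∏ k, y k = 1 := by
    rw [← Finset.mul_prod_erase _ _ (Finset.mem_univ i),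
      ← Finset.mul_prod_erase _ _ (Finset.mem_erase.2 ⟨hij, Finset.mem_univ j⟩),
      Finset.prod_eq_one]
    · simp [y, hij]
    · intro k hk
      simp only [Finset.mem_erase] at hk
      simp [y, hk.1, hk.2.1]
  have hy2 : ∏ k ∈ s, y k = 2 := by
    rw [← Finset.mul_prod_erase _ _ hi, Finset.prod_eq_one]
    · simp [y]
    · intro k hk
      have hkj : k ≠ j := fun e => hj (e ▸ (Finset.mem_erase.1 hk).2)
      simp [y, (Finset.mem_erase.1 hk).1, hkj]
  simp only [map_sub, map_mul, map_prod, MvPolynomial.eval_X, map_one, hy1, hy2, sub_self,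
    zero_mul] at hr'
  norm_num at hr'

theorem list_prod_q_ne_one [CharZero K] {n : ℕ} (w : List (Fin n)) (hw : w ≠ []) (hnd : w.Nodup)
    {j : Fin n} (hj : j ∉ w) : (w.map (q K)).prod ≠ 1 := by
  obtain ⟨i, hi⟩ := List.exists_mem_of_ne_nil w hw
  rw [← List.prod_toFinset _ hnd]
  exact prod_q_ne_one K _ (List.mem_toFinset.2 hi) (mt List.mem_toFinset.1 hj)

theorem prefixProd_succ {n : ℕ} (σ : Equiv.Perm (Fin n)) {k : ℕ} (hk : k < n) :
    prefixProd K σ (k + 1) = q K (σ ⟨k, hk⟩) * prefixProd K σ k := by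
  have : Finset.univ.filter (fun i : Fin n => (i : ℕ) < k + 1) =
      insert ⟨k, hk⟩ (Finset.univ.filter (fun i : Fin n => (i : ℕ) < k)) := by
    ext i
    simp only [Finset.mem_filter, Finset.mem_univ, true_and, Finset.mem_insert, Fin.ext_iff]
    omega
  rw [prefixProd, this, Finset.prod_insert (by simp), prefixProd]

/-- The reversal of the word formed by the first `k` letters of `σ`. -/
def revPrefix {n : ℕ} (σ : Equiv.Perm (Fin n)) (k : ℕ) : List (Fin n) :=
  ((List.ofFn σ).take k).reverse

theorem revPrefix_succ {n : ℕ} (σ : Equiv.Perm (Fin n)) {k : ℕ} (hk : k < n) :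
    revPrefix σ (k + 1) = σ ⟨k, hk⟩ :: revPrefix σ k := by
  rw [revPrefix, List.take_succ_eq_append_getElem (by simpa using hk), List.reverse_append]
  simp [revPrefix]

theorem prod_revPrefix {n : ℕ} (σ : Equiv.Perm (Fin n)) {k : ℕ} (hk : k ≤ n) :
    ((revPrefix σ k).map (q K)).prod = prefixProd K σ k := by
  induction k with
  | zero => simp [revPrefix, prefixProd]
  | succ k ih =>
    rw [revPrefix_succ σ hk, prefixProd_succ K σ hk, List.map_cons, List.prod_cons,
      ih (Nat.le_of_succ_le hk)]

/-- The letter at index `k` of `Fin n` has `k` letters before it, so it closes the descent position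
`k` counted from `1`. -/
theorem gate_revPrefix {n : ℕ} (σ : Equiv.Perm (Fin n)) {k : ℕ} (hk : k < n) :
    gate (q K) (σ ⟨k, hk⟩) (revPrefix σ k) =
      if k ∈ descentSet σ then prefixProd K σ k else 1 := by
  cases k with
  | zero => simp [revPrefix, gate, descentSet]
  | succ k =>
    have hk' : k < n := Nat.lt_of_succ_lt hk
    have hmem : k + 1 ∈ descentSet σ ↔ σ ⟨k + 1, hk⟩ < σ ⟨k, hk'⟩ := by
      simp only [descentSet, Finset.mem_filter, Finset.mem_Ico]
      constructor
      · rintro ⟨-, a, b, ha, hb, h⟩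
        obtain rfl : a = ⟨k, hk'⟩ := Fin.ext (by simpa using ha)
        obtain rfl : b = ⟨k + 1, hk⟩ := Fin.ext hb
        exact h
      · exact fun h => ⟨⟨by omega, hk⟩, ⟨k, hk'⟩, ⟨k + 1, hk⟩, rfl, rfl, h⟩
    rw [← prod_revPrefix K σ hk.le]
    simp only [revPrefix_succ σ hk', gate, hmem]

theorem chainGF_revPrefix {n : ℕ} (σ : Equiv.Perm (Fin n)) {k : ℕ} (hk : k ≤ n) :
    chainGF (q K) (revPrefix σ k) =
      (∏ j ∈ (descentSet σ).filter (· < k), prefixProd K σ j) /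
        ∏ i ∈ Finset.Ico 1 (k + 1), (1 - prefixProd K σ i) := by
  induction k with
  | zero => simp [revPrefix, chainGF]
  | succ k ih =>
    rw [revPrefix_succ σ hk, chainGF, gate_revPrefix, ← revPrefix_succ σ hk, prod_revPrefix K σ hk,
      ih (Nat.le_of_succ_le hk), Finset.prod_Ico_succ_top (by omega : 1 ≤ k + 1), mul_div_assoc',
      div_div]
    congr 1
    by_cases h : k ∈ descentSet σ
    · have : (descentSet σ).filter (· < k + 1) = insert k ((descentSet σ).filter (· < k)) := by
        ext i
        simp only [Finset.mem_filter, Finset.mem_insert]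
        grind
      rw [this, Finset.prod_insert (by simp), if_pos h]
    · have : (descentSet σ).filter (· < k + 1) = (descentSet σ).filter (· < k) := by
        ext i
        simp only [Finset.mem_filter]
        grind
      rw [this, if_neg h, one_mul]

/-- The last letter contributes only its gate, at position `n - 1`; the denominator `1 - 1` of the
full word is left out on both sides. -/
theorem majGF_reverse_ofFn {n : ℕ} (hn : 1 ≤ n) (σ : Equiv.Perm (Fin n)) :
    majGF (q K) (List.ofFn σ).reverse = qMaj K σ := by
  obtain ⟨m, rfl⟩ : ∃ m, n = m + 1 := ⟨n - 1, by omega⟩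
  have h : (List.ofFn σ).reverse = revPrefix σ (m + 1) := by
    rw [revPrefix, List.take_of_length_le (by simp)]
  rw [h, revPrefix_succ σ m.lt_succ_self, majGF, gate_revPrefix, chainGF_revPrefix K σ m.le_succ,
    qMaj, mul_div_assoc']
  congr 1
  by_cases h : m ∈ descentSet σ
  · have : descentSet σ = insert m ((descentSet σ).filter (· < m)) := by
      ext i
      have : i ∈ descentSet σ → i < m + 1 := fun hi =>
        (Finset.mem_Ico.1 (Finset.mem_filter.1 hi).1).2
      simp only [Finset.mem_filter, Finset.mem_insert]
      grind
    rw [if_pos h]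
    conv_rhs => rw [this]
    rw [Finset.prod_insert (by simp)]
  · have : (descentSet σ).filter (· < m) = descentSet σ := by
      ext i
      have : i ∈ descentSet σ → i < m + 1 := fun hi =>
        (Finset.mem_Ico.1 (Finset.mem_filter.1 hi).1).2
      simp only [Finset.mem_filter]
      grind
    rw [this, if_neg h, one_mul]

end Field

/-! ### Permutations as lists, factored around a chosen letter. -/

section Words

theorem sum_perm_eq_sum_lists {M : Type*} [AddCommMonoid M] {n : ℕ} (f : List (Fin n) → M) :
    ∑ σ : Equiv.Perm (Fin n), f (List.ofFn σ) =
      ∑ l ∈ (List.finRange n).permutations.toFinset, f l := by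
  refine Finset.sum_bij (fun σ _ => List.ofFn σ) (fun σ _ => ?_) (fun σ _ τ _ h => ?_)
    (fun l hl => ?_) fun _ _ => rfl
  · rw [List.mem_toFinset, List.mem_permutations,
      List.perm_ext_iff_of_nodup (List.nodup_ofFn.2 σ.injective) (List.nodup_finRange n)]
    intro a
    simpa [List.mem_ofFn] using σ.surjective a
  · exact Equiv.coe_fn_injective (List.ofFn_injective h)
  · rw [List.mem_toFinset, List.mem_permutations] at hl
    have hlen : l.length = n := by simpa using hl.length_eq
    have hinj : Function.Injective fun i : Fin n => l.get (i.cast hlen.symm) :=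
      (List.nodup_iff_injective_get.1 (hl.nodup_iff.2 (List.nodup_finRange n))).comp
        (Fin.cast_injective _)
    refine ⟨Equiv.ofBijective _ (Finite.injective_iff_bijective.1 hinj), Finset.mem_univ _, ?_⟩
    refine List.ext_get (by simp [hlen]) fun i h1 h2 => ?_
    simp

theorem append_cons_inj {α : Type*} {x : α} {a a' b b' : List α} (ha : x ∉ a) (ha' : x ∉ a')
    (h : a ++ x :: b = a' ++ x :: b') : a = a' ∧ b = b' := by
  induction a generalizing a' with
  | nil => cases a' <;> grind
  | cons c a ih => cases a' <;> grind

/-- The pairs of lists whose concatenation is a permutation of `l`. -/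
def permPairs {α : Type*} [DecidableEq α] (l : List α) : Finset (List α × List α) :=
  (l.permutations.toFinset ×ˢ Finset.range (l.length + 1)).image
    fun p => (p.1.take p.2, p.1.drop p.2)

theorem mem_permPairs {α : Type*} [DecidableEq α] {l : List α} {p : List α × List α} :
    p ∈ permPairs l ↔ (p.1 ++ p.2).Perm l := by
  simp only [permPairs, Finset.mem_image, Finset.mem_product, List.mem_toFinset,
    List.mem_permutations, Finset.mem_range]
  constructor
  · rintro ⟨⟨w, k⟩, ⟨hw, -⟩, rfl⟩
    simpa using hw
  · intro h
    refine ⟨(p.1 ++ p.2, p.1.length), ⟨h, ?_⟩, by simp⟩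
    have := h.length_eq
    rw [List.length_append] at this
    simp only
    omega

/-- The letter `x` occurs exactly once in a permutation of `x :: r`, so it cuts the list in a unique
way. -/
theorem sum_permPairs {α M : Type*} [DecidableEq α] [AddCommMonoid M] (x : α) (r : List α)
    (hx : x ∉ r) (f : List α → M) :
    ∑ p ∈ permPairs r, f (p.1.reverse ++ x :: p.2) =
      ∑ l ∈ (x :: r).permutations.toFinset, f l := by
  have hperm : ∀ a b : List α, (a.reverse ++ x :: b).Perm (x :: (a ++ b)) := fun a b =>
    List.perm_middle.trans ((a.reverse_perm.append_right b).cons x)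
  refine Finset.sum_bij (fun p _ => p.1.reverse ++ x :: p.2) (fun p hp => ?_)
    (fun p hp p' hp' h => ?_) (fun l hl => ?_) fun _ _ => rfl
  · rw [List.mem_toFinset, List.mem_permutations]
    exact (hperm _ _).trans ((mem_permPairs.1 hp).cons x)
  · have key : ∀ p ∈ permPairs r, x ∉ p.1.reverse := fun p hp h =>
      hx ((mem_permPairs.1 hp).mem_iff.1 (List.mem_append_left _ (List.mem_reverse.1 h)))
    obtain ⟨h1, h2⟩ := append_cons_inj (key p hp) (key p' hp') h
    exact Prod.ext (List.reverse_injective h1) h2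
  · rw [List.mem_toFinset, List.mem_permutations] at hl
    obtain ⟨s, t, rfl⟩ := List.append_of_mem (hl.mem_iff.2 List.mem_cons_self)
    refine ⟨(s.reverse, t), mem_permPairs.2 ?_, by simp⟩
    have h := hperm s.reverse t
    rw [List.reverse_reverse] at h
    exact (h.symm.trans hl).cons_inv

end Words

/-! ### Assembly of the bracket expansion. -/

/-- The `q`-Klyachko element as a combination of iterated brackets starting at the letter `0`. -/
theorem toWords_klyachko (K : Type*) [Field K] [CharZero K] (m : ℕ) :
    toWords K (m + 1) (klyachko K (m + 1)) =
      ∑ w ∈ ((List.finRange m).map Fin.succ).permutations.toFinset, majGF (q K) (0 :: w) •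
        w.foldl (fun z c => FreeAlgebra.ι (ParamField K (m + 1)) c * z -
          z * FreeAlgebra.ι (ParamField K (m + 1)) c)
          (FreeAlgebra.ι (ParamField K (m + 1)) (0 : Fin (m + 1))) := by
  set r : List (Fin (m + 1)) := (List.finRange m).map Fin.succ with hr
  have hfr : List.finRange (m + 1) = 0 :: r := List.finRange_succ
  have hnd : (0 :: r).Nodup := hfr ▸ List.nodup_finRange _
  have hprod : ((0 :: r).map (q K)).prod = 1 := by
    rw [← List.prod_toFinset _ hnd, ← hfr, List.toFinset_finRange, prod_q_univ]
  -- Such a `w` misses the letter `0`, so its product is a proper nonempty one and no denominator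
  -- vanishes.
  have hsub : ∀ w : List (Fin (m + 1)), w ≠ [] → w.Subperm r → (w.map (q K)).prod ≠ 1 := by
    intro w hw hs
    obtain ⟨w', hp, hs'⟩ := hs
    exact list_prod_q_ne_one K w hw (hp.nodup_iff.1 ((List.nodup_cons.1 hnd).2.sublist hs'))
      fun h0 => (List.nodup_cons.1 hnd).1 (hs'.subset (hp.mem_iff.2 h0))
  have hword : ∀ σ : Equiv.Perm (Fin (m + 1)),
      permWord K σ = listWord (ParamField K (m + 1)) (List.ofFn σ) := by
    intro σ
    rw [permWord, listWord, List.map_ofFn]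
    rfl
  have hL : toWords K (m + 1) (klyachko K (m + 1)) = ∑ σ : Equiv.Perm (Fin (m + 1)),
      majGF (q K) (List.ofFn σ).reverse • listWord (ParamField K (m + 1)) (List.ofFn σ) := by
    rw [klyachko, map_sum]
    refine Finset.sum_congr rfl fun σ _ => ?_
    rw [toWords, Finsupp.linearCombination_single, hword, majGF_reverse_ofFn K (by omega)]
  rw [hL, sum_perm_eq_sum_lists fun l => majGF (q K) l.reverse • listWord _ l, hfr,
    ← sum_permPairs 0 r (List.nodup_cons.1 hnd).1]
  simp only [foldl_bracket, List.smul_sum, List.map_map]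
  rw [sum_splits_eq_sum_shuffle _ (permPairs r)]
  · refine Finset.sum_congr rfl fun p hp => ?_
    have hp := mem_permPairs.1 hp
    have hpx : (p.2 ++ 0 :: p.1).Perm (0 :: r) :=
      List.perm_middle.trans ((List.perm_append_comm.trans hp).cons 0)
    have h1 := majGF_reverse_append (q K) p.2 0 p.1 (hpx.nodup_iff.2 hnd)
      (by rw [(hpx.map _).prod_eq, hprod]) fun w hw hs =>
        hsub w hw (hs.trans ((List.sublist_append_right _ _).subperm.trans hp.subperm))
    have h2 := sum_shuffle_chainGF (q K) p.1 p.2 (hp.nodup_iff.2 (List.nodup_cons.1 hnd).2)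
      (fun w hw hs => hsub w hw (hs.trans hp.subperm)) 0
    have h3 : listWord (ParamField K (m + 1)) (p.1.reverse ++ 0 :: p.2) =
        listWord _ p.1.reverse * FreeAlgebra.ι _ 0 * listWord _ p.2 := by
      simp [listWord, mul_assoc]
    -- The reversal of `p.1.reverse ++ 0 :: p.2` is `p.2.reverse ++ 0 :: p.1`, to which `h1`
    -- applies; `h2` then turns the product into a sum of terms that are `majGF (q K) (0 :: w)` by
    -- definition.
    rw [List.reverse_append, List.reverse_cons, List.reverse_reverse, List.append_assoc,
      List.singleton_append, h1, ← h2, h3, mul_comm, mul_smul, List.sum_smul, List.map_map]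
    rfl
  · intro w hw p hp
    rw [List.mem_toFinset, List.mem_permutations] at hw
    exact mem_permPairs.2 ((perm_of_mem_splits w p hp).symm.trans hw)
  · intro p hp w hw
    rw [List.mem_toFinset, List.mem_permutations]
    exact (perm_of_mem_shuffle _ _ w hw).trans (mem_permPairs.1 hp)

attribute [local instance] LieRing.ofAssociativeRing in
theorem toWords_klyachko_mem_freeLie (K : Type*) [Field K] [CharZero K] (m : ℕ) :
    toWords K (m + 1) (klyachko K (m + 1)) ∈ freeLie K (m + 1) := by
  have hι : ∀ c, FreeAlgebra.ι (ParamField K (m + 1)) c ∈ freeLie K (m + 1) :=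
    fun c => LieSubalgebra.subset_lieSpan (Set.mem_range_self c)
  rw [toWords_klyachko]
  exact (freeLie K (m + 1)).toSubmodule.sum_mem fun w _ =>
    (freeLie K (m + 1)).toSubmodule.smul_mem _ (foldl_bracket_mem _ hι w _ (hι 0))

end QKlyachko

theorem mainTheorem2 (K : Type*) [Field K] [CharZero K] (n : ℕ) (hn : 1 ≤ n) :
    QKlyachko.toWords K n (QKlyachko.klyachko K n) ∈ QKlyachko.lieElements K n := by
  obtain ⟨m, rfl⟩ : ∃ m, n = m + 1 := ⟨n - 1, by omega⟩
  exact ⟨LinearMap.mem_range_self _ _, QKlyachko.toWords_klyachko_mem_freeLie K m⟩
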